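/- Let $T$ be a commutative domain in which $2$ is invertible, let $V$ be a free $T$-module of rank $n\ge 1$ with $T$-basis $x_1,\dots,x_n$, and let $q:V\to T$ be a quadratic form. Let $$A=C(V,q)=T\langle V\rangle/(x^2-q(x)\mid x\in V)$$ be its Clifford algebra, and put $b(x,y)=\tfrac12\big(q(x+y)-q(x)-q(y)\big)$ and $\det(q)=\det\big(b(x_i,x_j)\big)_{n\times n}$. Then $T$ embeds in $A$ as a central subalgebra, $A$ is a free $T$-module of finite rank, the elements $x_ix_j+x_jx_i$ of $A$ lie in $T$, and $$d(A/T)=_{T^\times}\Big(\det\big(x_ix_j+x_jx_i\big)_{n\times n}\Big)^{2^{n-1}}=_{T^\times}\det(q)^{2^{n-1}} .$$ Here $a=_{T^\times}b$ means $a=cb$ for some unit $c\in T^\times$, and $d(A/T)$ is the discriminant of $A$ over $T$, that is, $d(A/T)=\det\big(\operatorname{tr}(z_iz_j)\big)_{r\times r}$ for any $T$-basis $z_1,\dots,z_r$ of $A$, where $\operatorname{tr}(a)$ is the trace of the $T$-linear map $A\to A$, $y\mapsto ay$; the assertion holds for every choice of this basis. -/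

import Mathlib

/-- The regular trace of a (not necessarily commutative) algebra `A` over a commutative ring `Z`:
the trace of the `Z`-linear endomorphism `b ↦ a * b` of `A`. (`Algebra.trace` is the same thing,
but is only available for commutative `A`.) It is used for `A` finitely generated and free. -/
noncomputable def regularTrace (Z A : Type*) [CommRing Z] [Ring A] [Algebra Z A] (a : A) : Z :=
  LinearMap.trace Z A (LinearMap.mulLeft Z a)

/-- The discriminant `det (tr (z i * z j))` of `A` over `Z`, computed in the `Z`-basis
`z 0, …, z (r - 1)` of `A`. -/
noncomputable def basisDiscriminant {Z A : Type*} [CommRing Z] [Ring A] [Algebra Z A] {r : ℕ}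
    (z : Module.Basis (Fin r) Z A) : Z :=
  (Matrix.of fun i j => regularTrace Z A (z i * z j)).det

/-! As $2$ is invertible, `equivExterior` identifies $A$ linearly with the exterior algebra, so
every basis of $V$ gives a monomial basis $(e_S)$ of $A$. Changing basis multiplies the trace-form
determinant by the square of a unit, so one monomial basis suffices.

For an orthogonal basis, $e_Se_U=\pm\prod_{i\in S\cap U}q(e_i)\,e_{S\triangle U}$
(`exists_monomialBasis_mul`). Hence $\operatorname{tr}(e_S)=0$ for $S\ne\emptyset$, and
$\operatorname{tr}(1)=2^n$. The trace form is then diagonal, with determinant $\pm(2^n)^{2^n}\prod_i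
q(e_i)^{2^{n-1}}$.

Over the fraction field an orthogonal basis exists. A change of basis $P$ of $V$ acts on the
exterior algebra with determinant $\det(P)^{2^{n-1}}$ (`ExteriorAlgebra.det_map`), so both sides of
the formula scale alike and it holds for any basis. Applied to the image of the given basis, it
descends to $T$ because only a sign and a power of $2$ intervene. -/

open Module

/-! ### Trace forms under change of basis and of scalars -/

section TraceForm

variable (Z A : Type*) [CommRing Z] [Ring A] [Algebra Z A]

/-- The trace form `(a, b) ↦ tr (a * b)` of the regular representation. -/
noncomputable def regularTraceForm : LinearMap.BilinForm Z A :=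
  (LinearMap.mul Z A).compr₂ (LinearMap.trace Z A ∘ₗ (Algebra.lmul Z A).toLinearMap)

lemma regularTraceForm_apply (a b : A) : regularTraceForm Z A a b = regularTrace Z A (a * b) := rfl

variable {Z A}

lemma regularTrace_smul (c : Z) (a : A) : regularTrace Z A (c • a) = c * regularTrace Z A a := by
  have := map_smul (LinearMap.trace Z A ∘ₗ (Algebra.lmul Z A).toLinearMap) c a
  exact this

lemma det_regularTraceForm_toMatrix_change {I : Type*} [Fintype I] [DecidableEq I]
    (z w : Basis I Z A) :
    (LinearMap.BilinForm.toMatrix w (regularTraceForm Z A)).det =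
      (z.toMatrix w).det ^ 2 * (LinearMap.BilinForm.toMatrix z (regularTraceForm Z A)).det := by
  rw [← LinearMap.BilinForm.toMatrix_mul_basis_toMatrix z w, Matrix.det_mul, Matrix.det_mul,
    Matrix.det_transpose]
  ring

lemma basisDiscriminant_eq_det_regularTraceForm {r : ℕ} (z : Basis (Fin r) Z A) :
    basisDiscriminant z = (LinearMap.BilinForm.toMatrix z (regularTraceForm Z A)).det := by
  rw [basisDiscriminant]
  congr 1
  ext i j
  simp [LinearMap.BilinForm.toMatrix_apply, regularTraceForm_apply]

/-- The discriminants of an algebra in any two bases are associated. -/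
lemma associated_basisDiscriminant {I : Type*} [Fintype I] [DecidableEq I] [Nontrivial Z] {r : ℕ}
    (z : Basis (Fin r) Z A) (w : Basis I Z A) :
    Associated (basisDiscriminant z)
      (LinearMap.BilinForm.toMatrix w (regularTraceForm Z A)).det := by
  -- The index types match because ranks over a nontrivial commutative ring are well defined.
  let e := z.indexEquiv w
  have h : (LinearMap.BilinForm.toMatrix (z.reindex e) (regularTraceForm Z A)) =
      (LinearMap.BilinForm.toMatrix z (regularTraceForm Z A)).submatrix e.symm e.symm := by
    ext i j
    simp [LinearMap.BilinForm.toMatrix_apply]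
  rw [basisDiscriminant_eq_det_regularTraceForm, ← Matrix.det_submatrix_equiv_self e.symm, ← h,
    det_regularTraceForm_toMatrix_change w (z.reindex e), mul_comm]
  have hu : IsUnit (w.toMatrix (z.reindex e)).det := by
    have := w.invertibleToMatrix (z.reindex e)
    exact (Matrix.isUnit_iff_isUnit_det _).1 (isUnit_of_invertible _)
  exact (associated_mul_unit_left _ _ (hu.pow 2))

/-- The regular trace is compatible with ring extensions that carry a basis to a
basis. -/
lemma regularTrace_map {K A' I : Type*} [CommRing K] [Ring A'] [Algebra K A'] [Algebra Z K]
    [Algebra Z A'] [IsScalarTower Z K A'] [Fintype I] [DecidableEq I] (F : A →ₐ[Z] A')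
    (z : Basis I Z A) (z' : Basis I K A') (h : ∀ i, z' i = F (z i)) (a : A) :
    regularTrace K A' (F a) = algebraMap Z K (regularTrace Z A a) := by
  have hr (y : A) (i : I) : z'.repr (F y) i = algebraMap Z K (z.repr y i) := by
    have hy : F y = ∑ j, algebraMap Z K (z.repr y j) • z' j := by
      conv_lhs => rw [← z.sum_repr y, map_sum]
      exact Finset.sum_congr rfl fun j _ => by rw [map_smul, h, algebraMap_smul]
    rw [hy, z'.repr_sum_self]
  rw [regularTrace, regularTrace, LinearMap.trace_eq_matrix_trace K z',
    LinearMap.trace_eq_matrix_trace Z z, Matrix.trace, Matrix.trace, map_sum]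
  refine Finset.sum_congr rfl fun i _ => ?_
  rw [Matrix.diag_apply, Matrix.diag_apply, LinearMap.toMatrix_apply, LinearMap.toMatrix_apply,
    LinearMap.mulLeft_apply, LinearMap.mulLeft_apply, h, ← map_mul, hr]

lemma det_regularTraceForm_map {K A' I : Type*} [CommRing K] [Ring A'] [Algebra K A'] [Algebra Z K]
    [Algebra Z A'] [IsScalarTower Z K A'] [Fintype I] [DecidableEq I] (F : A →ₐ[Z] A')
    (z : Basis I Z A) (z' : Basis I K A') (h : ∀ i, z' i = F (z i)) :
    (LinearMap.BilinForm.toMatrix z' (regularTraceForm K A')).det =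
      algebraMap Z K (LinearMap.BilinForm.toMatrix z (regularTraceForm Z A)).det := by
  rw [RingHom.map_det]
  congr 1
  ext i j
  simp [LinearMap.BilinForm.toMatrix_apply, regularTraceForm_apply, h, ← map_mul,
    regularTrace_map F z z' h]

end TraceForm

/-! ### Determinants on the exterior algebra -/

section ExteriorDet

/-- Each index lies in exactly half of the subsets. -/
lemma Finset.prod_univ_prod_mem {I M : Type*} [Fintype I] [DecidableEq I] [CommMonoid M]
    (d : I → M) : ∏ S : Finset I, ∏ i ∈ S, d i = (∏ i, d i) ^ 2 ^ (Fintype.card I - 1) := by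
  rw [Finset.prod_comm' (t' := Finset.univ) (s' := fun i => Finset.univ.filter (i ∈ ·)) (by simp),
    ← Finset.prod_pow]
  refine Finset.prod_congr rfl fun i _ => ?_
  rw [Finset.prod_const]
  congr 1
  have : Finset.univ.filter (fun S : Finset I => i ∈ S) =
      (Finset.univ.erase i).powerset.image (insert i) := by
    ext S
    simp only [Finset.mem_filter, Finset.mem_univ, true_and, Finset.mem_image,
      Finset.mem_powerset]
    constructor
    · intro h
      exact ⟨S.erase i, Finset.erase_subset_erase _ (Finset.subset_univ _), Finset.insert_erase h⟩
    · rintro ⟨U, -, rfl⟩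
      exact Finset.mem_insert_self _ _
  rw [this, Finset.card_image_of_injOn, Finset.card_powerset, Finset.card_erase_of_mem
    (Finset.mem_univ _), Finset.card_univ]
  intro S hS U hU h
  have hS : i ∉ S := fun hi => by simpa using Finset.mem_powerset.1 hS hi
  have hU : i ∉ U := fun hi => by simpa using Finset.mem_powerset.1 hU hi
  rw [← Finset.erase_insert hS, ← Finset.erase_insert hU]
  exact congrArg (Finset.erase · i) h

variable {R V W I : Type*} [CommRing R] [AddCommGroup V] [Module R V] [AddCommGroup W] [Module R W]
  [LinearOrder I]

lemma ExteriorAlgebra.map_basis (b : Basis I R V) (b' : Basis I R W) (f : V →ₗ[R] W) (d : I → R)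
    (h : ∀ i, f (b i) = d i • b' i) (S : Finset I) :
    ExteriorAlgebra.map f (b.ExteriorAlgebra S) = (∏ i ∈ S, d i) • b'.ExteriorAlgebra S := by
  rw [ExteriorAlgebra.basis_apply_ofCard b rfl, ExteriorAlgebra.basis_apply_ofCard b' rfl,
    ExteriorAlgebra.ιMulti_family, ExteriorAlgebra.map_apply_ιMulti]
  have : f ∘ b ∘ (Set.powersetCard.ofFinEmbEquiv.symm (Set.powersetCard.ofCard (rfl : S.card = _)))
      = fun k => (d ∘ (Set.powersetCard.ofFinEmbEquiv.symm
          (Set.powersetCard.ofCard (rfl : S.card = _)))) k •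
        (b' ∘ (Set.powersetCard.ofFinEmbEquiv.symm
          (Set.powersetCard.ofCard (rfl : S.card = _)))) k := by
    ext k
    simp [h]
  rw [this, AlternatingMap.map_smul_univ]
  congr 1
  rw [← Finset.prod_coe_sort S d, ← (S.orderIsoOfFin rfl).toEquiv.prod_comp]
  rfl

variable [Fintype I]

lemma ExteriorAlgebra.det_map_of_diagonal (b : Basis I R V) (f : V →ₗ[R] V) (d : I → R)
    (h : ∀ i, f (b i) = d i • b i) :
    LinearMap.det (ExteriorAlgebra.map f).toLinearMap = (∏ i, d i) ^ 2 ^ (Fintype.card I - 1) := by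
  rw [← LinearMap.det_toMatrix b.ExteriorAlgebra, ← Finset.prod_univ_prod_mem, ← Matrix.det_diagonal]
  congr 1
  ext S U
  rw [LinearMap.toMatrix_apply, AlgHom.toLinearMap_apply, ExteriorAlgebra.map_basis b b f d h,
    map_smul, Basis.repr_self, Finsupp.smul_apply, Finsupp.single_apply, Matrix.diagonal_apply]
  by_cases hSU : S = U
  · simp [hSU]
  · simp [hSU, Ne.symm hSU]

/-- The determinant of the map induced on the exterior algebra. -/
lemma ExteriorAlgebra.det_map {K V : Type*} [Field K] [NeZero (2 : K)] [AddCommGroup V]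
    [Module K V] (b : Basis I K V) (f : V →ₗ[K] V) :
    LinearMap.det (ExteriorAlgebra.map f).toLinearMap =
      LinearMap.det f ^ 2 ^ (Fintype.card I - 1) := by
  set N := 2 ^ (Fintype.card I - 1)
  have hN : N ≠ 0 := by positivity
  let D (M : Matrix I I K) : K :=
    LinearMap.det (ExteriorAlgebra.map (Matrix.toLin b b M)).toLinearMap
  have hmul (M M' : Matrix I I K) : D (M * M') = D M * D M' := by
    simp only [D]
    rw [Matrix.toLin_mul b b b, ← ExteriorAlgebra.map_comp_map, AlgHom.comp_toLinearMap,
      LinearMap.det_comp]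
  have hdiag (d : I → K) : D (Matrix.diagonal d) = (Matrix.diagonal d).det ^ N := by
    rw [Matrix.det_diagonal]
    refine ExteriorAlgebra.det_map_of_diagonal b _ d fun i => ?_
    rw [Matrix.toLin_self]
    simp [Matrix.diagonal_apply, ite_smul]
  have htrans (i j : I) (hij : i ≠ j) (c : K) : D (Matrix.transvection i j c) = 1 := by
    have hne : D (Matrix.transvection i j c) ≠ 0 := by
      intro h0
      have h1 := hmul (Matrix.transvection i j c) (Matrix.transvection i j (-c))
      rw [Matrix.transvection_mul_transvection_same i j hij, add_neg_cancel,
        Matrix.transvection_zero, h0, zero_mul, ← Matrix.diagonal_one, hdiag] at h1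
      simp at h1
    -- Scaling the `i`-th coordinate by $2$ conjugates the transvection $t$ to $t^2$, so
    -- $D(t)=D(t)^2$ with $D(t)\ne0$, which forces $D(t)=1$.
    let E : Matrix I I K := Matrix.diagonal (Function.update 1 i 2)
    have hE : D E ≠ 0 := by
      rw [hdiag, Matrix.det_diagonal]
      refine pow_ne_zero _ (Finset.prod_ne_zero_iff.2 fun k _ => ?_)
      rcases eq_or_ne k i with rfl | hk
      · simpa using NeZero.ne (2 : K)
      · simp [hk]
    have hconj : E * Matrix.transvection i j c =
        Matrix.transvection i j c * Matrix.transvection i j c * E := by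
      rw [Matrix.transvection_mul_transvection_same i j hij]
      simp only [E, Matrix.transvection, mul_add, add_mul, mul_one, one_mul]
      congr 1
      ext k l
      simp only [Matrix.diagonal_mul, Matrix.mul_diagonal, Matrix.single_apply]
      by_cases h : i = k ∧ j = l
      · obtain ⟨rfl, rfl⟩ := h
        simp [hij.symm, two_mul]
      · simp [h]
    have h2 := congrArg D hconj
    rw [hmul, hmul, hmul, mul_comm] at h2
    have h3 := mul_right_cancel₀ hE h2
    exact (mul_left_cancel₀ hne (by rw [mul_one]; exact h3)).symm
  have key (M : Matrix I I K) : D M = M.det ^ N := by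
    induction M using Matrix.diagonal_transvection_induction with
    | hdiag d _ => exact hdiag d
    | htransvec t => rw [Matrix.TransvectionStruct.toMatrix, htrans _ _ t.hij,
        Matrix.det_transvection_of_ne _ _ t.hij, one_pow]
    | hmul A B hA hB => rw [hmul, hA, hB, Matrix.det_mul, mul_pow]
  have := key (LinearMap.toMatrix b b f)
  simpa [D] using this

/-- The determinant of a change of basis in the exterior algebra. -/
lemma ExteriorAlgebra.det_basis_toMatrix {K V : Type*} [Field K] [NeZero (2 : K)]
    [AddCommGroup V] [Module K V] (b b' : Basis I K V) :
    (b.ExteriorAlgebra.toMatrix b'.ExteriorAlgebra).det =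
      (b.toMatrix b').det ^ 2 ^ (Fintype.card I - 1) := by
  let f : V →ₗ[K] V := b.constr K b'
  have h (i : I) : f (b i) = b' i := b.constr_basis K b' i
  have h1 : b.toMatrix b' = LinearMap.toMatrix b b f := by
    ext i j
    simp [Basis.toMatrix_apply, LinearMap.toMatrix_apply, h]
  have h2 : b.ExteriorAlgebra.toMatrix b'.ExteriorAlgebra =
      LinearMap.toMatrix b.ExteriorAlgebra b.ExteriorAlgebra
        (ExteriorAlgebra.map f).toLinearMap := by
    ext S U
    rw [Basis.toMatrix_apply, LinearMap.toMatrix_apply, AlgHom.toLinearMap_apply,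
      ExteriorAlgebra.map_basis b b' f 1 (by simp [h])]
    simp
  rw [h1, h2, LinearMap.det_toMatrix, LinearMap.det_toMatrix, ExteriorAlgebra.det_map b]

end ExteriorDet

/-! ### Clifford multiplication in an orthogonal basis -/

section OrthogonalBasis

variable {R V I : Type*} [CommRing R] [AddCommGroup V] [Module R V] [LinearOrder I]

namespace ExteriorAlgebra

lemma basis_empty (b : Basis I R V) : b.ExteriorAlgebra ∅ = 1 := by
  rw [basis_apply_ofCard b (n := 0) rfl, ιMulti_family, ιMulti_zero_apply]

lemma basis_singleton (b : Basis I R V) (i : I) : b.ExteriorAlgebra {i} = ι R (b i) := by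
  have h : Set.powersetCard.ofFinEmbEquiv.symm
      (Set.powersetCard.ofCard (n := 1) (Finset.card_singleton i)) 0 = i := by
    have := (Set.powersetCard.mem_range_ofFinEmbEquiv_symm_iff_mem
      (Set.powersetCard.ofCard (n := 1) (Finset.card_singleton i)) i).2 (Finset.mem_singleton_self i)
    obtain ⟨k, hk⟩ := this
    rwa [Subsingleton.elim k 0] at hk
  rw [basis_apply_ofCard b (Finset.card_singleton i), ιMulti_family, ιMulti_succ_apply, ιMulti_zero_apply,
    mul_one, Function.comp_apply, h]

/-- The scalar is the sign of a shuffle; only its square matters later, since results are needed up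
to units. -/
lemma exists_ι_mul_basis (b : Basis I R V) {i : I} {S : Finset I} (hi : i ∉ S) :
    ∃ u : R, u ^ 2 = 1 ∧ ι R (b i) * b.ExteriorAlgebra S = u • b.ExteriorAlgebra (insert i S) := by
  have h := basis_mul_of_disjoint b (Set.powersetCard.ofCard (n := 1) (Finset.card_singleton i))
    (Set.powersetCard.ofCard (s := S) rfl) (by simpa using hi)
  simp only [Set.powersetCard.val_ofCard, basis_singleton] at h
  obtain ⟨σ, h⟩ : ∃ σ : ℤˣ, ι R (b i) * b.ExteriorAlgebra S =
      σ • b.ExteriorAlgebra (insert i S) := by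
    rw [Finset.insert_eq, ← Finset.disjUnion_eq_union _ _ (by simpa using hi)]
    exact ⟨_, h⟩
  refine ⟨(σ : ℤ), ?_, h.trans ?_⟩
  · rw [← Int.cast_pow, ← Units.val_pow_eq_pow_val, Int.units_sq]
    simp
  · rw [Units.smul_def, Int.cast_smul_eq_zsmul]

lemma contractLeft_ιMulti_eq_zero (d : Module.Dual R V) {n : ℕ} (v : Fin n → V)
    (h : ∀ k, d (v k) = 0) : CliffordAlgebra.contractLeft d (ιMulti R n v) = 0 := by
  induction n with
  | zero => simp
  | succ n ih =>
    rw [ιMulti_succ_apply, CliffordAlgebra.contractLeft_ι_mul, h, zero_smul,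
      ih (Matrix.vecTail v) fun k => h k.succ, mul_zero, sub_zero]

lemma contractLeft_coord_basis_of_notMem (b : Basis I R V) {i : I} {S : Finset I} (hi : i ∉ S) :
    CliffordAlgebra.contractLeft (b.coord i) (b.ExteriorAlgebra S) = 0 := by
  rw [basis_apply_ofCard b rfl]
  refine contractLeft_ιMulti_eq_zero _ _ fun k => ?_
  have : Set.powersetCard.ofFinEmbEquiv.symm
      (Set.powersetCard.ofCard (rfl : S.card = S.card)) k ≠ i := by
    rintro rfl
    exact hi ((Set.powersetCard.mem_range_ofFinEmbEquiv_symm_iff_mem _ _).1 ⟨k, rfl⟩)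
  simp [Finsupp.single_eq_of_ne this.symm]

end ExteriorAlgebra

namespace CliffordAlgebra

variable [Invertible (2 : R)] (q : QuadraticForm R V) (b : Basis I R V)

/-- The basis of a Clifford algebra obtained from the monomial basis of the exterior algebra. -/
noncomputable def monomialBasis : Basis (Finset I) R (CliffordAlgebra q) :=
  b.ExteriorAlgebra.map (equivExterior q).symm

lemma equivExterior_monomialBasis (S : Finset I) :
    equivExterior q (monomialBasis q b S) = b.ExteriorAlgebra S := by
  rw [monomialBasis, Basis.map_apply, LinearEquiv.apply_symm_apply]

lemma monomialBasis_empty : monomialBasis q b ∅ = 1 := by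
  apply (equivExterior q).injective
  rw [equivExterior_monomialBasis, ExteriorAlgebra.basis_empty]
  exact (changeForm_one changeForm.associated_neg_proof).symm

/-- Clifford multiplication by a vector becomes wedge plus contraction. The sign is positive because
`equivExterior` changes the form by $-q$. -/
lemma equivExterior_ι_mul (m : V) (y : CliffordAlgebra q) :
    equivExterior q (ι q m * y) =
      ExteriorAlgebra.ι R m * equivExterior q y +
        contractLeft (QuadraticMap.associated (R := R) q m) (equivExterior q y) := by
  refine (changeForm_ι_mul changeForm.associated_neg_proof m y).trans ?_
  have hneg : QuadraticMap.associated (R := R) (-q) m = -QuadraticMap.associated (R := R) q m := by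
    rw [map_neg, LinearMap.neg_apply]
  have hc (d : Module.Dual R V) (x : ExteriorAlgebra R V) :
      contractLeft (-d) x = -contractLeft d x := by
    rw [map_neg, LinearMap.neg_apply]
  rw [hneg, hc, sub_neg_eq_add]
  rfl

variable {q b} (hb : (QuadraticMap.associated (R := R) q).IsOrthoᵢ b)

include hb

omit [LinearOrder I] in
lemma associated_eq_smul_coord (i : I) :
    QuadraticMap.associated (R := R) q (b i) = q (b i) • b.coord i := by
  refine b.ext fun j => ?_
  rcases eq_or_ne i j with rfl | h
  · simp [QuadraticMap.associated_eq_self_apply]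
  · have : QuadraticMap.associated (R := R) q (b i) (b j) = 0 := hb h
    rw [this]
    simp [Finsupp.single_eq_of_ne h]

/-- By orthogonality the contraction is along a multiple of the $i$-th coordinate, which kills
$e_S$; only the wedge remains. -/
lemma exists_ι_mul_monomialBasis_of_notMem {i : I} {S : Finset I} (hi : i ∉ S) :
    ∃ u : R, u ^ 2 = 1 ∧ ι q (b i) * monomialBasis q b S = u • monomialBasis q b (insert i S) := by
  obtain ⟨u, hu, h⟩ := ExteriorAlgebra.exists_ι_mul_basis b hi
  refine ⟨u, hu, (equivExterior q).injective ?_⟩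
  rw [equivExterior_ι_mul, map_smul, equivExterior_monomialBasis, equivExterior_monomialBasis, h,
    associated_eq_smul_coord hb, map_smul, LinearMap.smul_apply,
    ExteriorAlgebra.contractLeft_coord_basis_of_notMem b hi, smul_zero, add_zero]

/-- Write $e_S=\pm e_ie_{S\setminus i}$ and use $e_i^2=q(e_i)$. -/
lemma exists_ι_mul_monomialBasis_of_mem {i : I} {S : Finset I} (hi : i ∈ S) :
    ∃ u : R, u ^ 2 = 1 ∧
      ι q (b i) * monomialBasis q b S = (u * q (b i)) • monomialBasis q b (S.erase i) := by
  obtain ⟨u, hu, h⟩ := exists_ι_mul_monomialBasis_of_notMem hb (S.notMem_erase i)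
  rw [Finset.insert_erase hi] at h
  refine ⟨u, hu, ?_⟩
  have h1 : monomialBasis q b S = u • (ι q (b i) * monomialBasis q b (S.erase i)) := by
    rw [h, smul_smul, ← sq, hu, one_smul]
  rw [h1, mul_smul_comm, ← mul_assoc, ι_sq_scalar, ← Algebra.smul_def, smul_smul]

lemma exists_ι_mul_monomialBasis (i : I) (S : Finset I) :
    ∃ u : R, u ^ 2 = 1 ∧ ι q (b i) * monomialBasis q b S =
      (u * if i ∈ S then q (b i) else 1) • monomialBasis q b (symmDiff {i} S) := by
  by_cases hi : i ∈ S
  · obtain ⟨u, hu, h⟩ := exists_ι_mul_monomialBasis_of_mem hb hi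
    refine ⟨u, hu, ?_⟩
    have : symmDiff {i} S = S.erase i := by
      ext j
      simp only [Finset.mem_symmDiff, Finset.mem_singleton, Finset.mem_erase]
      grind
    rw [h, this, if_pos hi]
  · obtain ⟨u, hu, h⟩ := exists_ι_mul_monomialBasis_of_notMem hb hi
    refine ⟨u, hu, ?_⟩
    have : symmDiff {i} S = insert i S := by
      ext j
      simp only [Finset.mem_symmDiff, Finset.mem_singleton, Finset.mem_insert]
      grind
    rw [h, this, if_neg hi, mul_one]

/-- Monomials in an orthogonal basis multiply up to sign by symmetric difference. -/
lemma exists_monomialBasis_mul (S U : Finset I) :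
    ∃ u : R, u ^ 2 = 1 ∧ monomialBasis q b S * monomialBasis q b U =
      (u * ∏ i ∈ S ∩ U, q (b i)) • monomialBasis q b (symmDiff S U) := by
  induction S using Finset.induction_on with
  | empty => exact ⟨1, one_pow 2, by
      rw [monomialBasis_empty, one_mul, ← Finset.bot_eq_empty, bot_symmDiff]
      simp⟩
  | insert i S hi ih =>
    obtain ⟨u, hu, h⟩ := exists_ι_mul_monomialBasis_of_notMem hb hi
    obtain ⟨v, hv, h'⟩ := ih
    obtain ⟨w, hw, h''⟩ := exists_ι_mul_monomialBasis hb i (symmDiff S U)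
    refine ⟨u * v * w, by rw [mul_pow, mul_pow, hu, hv, hw]; simp, ?_⟩
    have h1 : monomialBasis q b (insert i S) = u • (ι q (b i) * monomialBasis q b S) := by
      rw [h, smul_smul, ← sq, hu, one_smul]
    have h2 : symmDiff {i} (symmDiff S U) = symmDiff (insert i S) U := by
      rw [← symmDiff_assoc]
      congr 1
      ext j
      simp only [Finset.mem_symmDiff, Finset.mem_singleton, Finset.mem_insert]
      grind
    -- Since $i\notin S$, membership in $S\triangle U$ just means $i\in U$.
    have h3 : (∏ j ∈ insert i S ∩ U, q (b j)) =
        (if i ∈ symmDiff S U then q (b i) else 1) * ∏ j ∈ S ∩ U, q (b j) := by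
      by_cases hU : i ∈ U
      · rw [Finset.insert_inter_of_mem hU, Finset.prod_insert (by simp [hi]),
          if_pos (by simp [Finset.mem_symmDiff, hi, hU])]
      · rw [Finset.insert_inter_of_notMem hU, if_neg (by simp [Finset.mem_symmDiff, hi, hU]),
          one_mul]
    rw [h1, smul_mul_assoc, mul_assoc, h', mul_smul_comm, h'', smul_smul, smul_smul, h2, h3]
    congr 1
    ring

variable [Fintype I]

/-- For $S\ne\emptyset$ the map $U\mapsto S\triangle U$ has no fixed point, so the diagonal
vanishes. -/
lemma regularTrace_monomialBasis (S : Finset I) :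
    regularTrace R (CliffordAlgebra q) (monomialBasis q b S) =
      if S = ∅ then 2 ^ Fintype.card I else 0 := by
  rw [regularTrace, LinearMap.trace_eq_matrix_trace R (monomialBasis q b)]
  split_ifs with hS
  · rw [hS, monomialBasis_empty, LinearMap.mulLeft_one, LinearMap.toMatrix_id, Matrix.trace_one,
      Fintype.card_finset]
    simp
  · refine Finset.sum_eq_zero fun U _ => ?_
    obtain ⟨u, -, h⟩ := exists_monomialBasis_mul hb S U
    rw [Matrix.diag_apply, LinearMap.toMatrix_apply, LinearMap.mulLeft_apply, h, map_smul,
      Basis.repr_self, Finsupp.smul_apply, Finsupp.single_eq_of_ne, smul_zero]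
    intro h'
    exact hS (by simpa using h'.symm)

lemma exists_det_regularTraceForm_of_isOrtho :
    ∃ u : R, u ^ 2 = 1 ∧
      (LinearMap.BilinForm.toMatrix (monomialBasis q b)
        (regularTraceForm R (CliffordAlgebra q))).det =
      u * ((2 ^ Fintype.card I) ^ 2 ^ Fintype.card I *
        (∏ i, q (b i)) ^ 2 ^ (Fintype.card I - 1)) := by
  choose u hu h using fun S : Finset I => exists_monomialBasis_mul hb S S
  refine ⟨∏ S, u S, by rw [← Finset.prod_pow]; simp [hu], ?_⟩
  have hd : LinearMap.BilinForm.toMatrix (monomialBasis q b)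
      (regularTraceForm R (CliffordAlgebra q)) =
      Matrix.diagonal fun S => u S * (2 ^ Fintype.card I * ∏ i ∈ S, q (b i)) := by
    ext S U
    rw [LinearMap.BilinForm.toMatrix_apply, regularTraceForm_apply, Matrix.diagonal_apply]
    split_ifs with hSU
    · rw [← hSU, h, regularTrace_smul, symmDiff_self, regularTrace_monomialBasis hb,
        if_pos Finset.bot_eq_empty, Finset.inter_self]
      ring
    · obtain ⟨v, -, hv⟩ := exists_monomialBasis_mul hb S U
      rw [hv, regularTrace_smul, regularTrace_monomialBasis hb, if_neg, mul_zero]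
      rwa [← Finset.bot_eq_empty, symmDiff_eq_bot]
  rw [hd, Matrix.det_diagonal, Finset.prod_mul_distrib, Finset.prod_mul_distrib,
    Finset.prod_univ_prod_mem, Finset.prod_const, Finset.card_univ, Fintype.card_finset]

end CliffordAlgebra

end OrthogonalBasis

/-! ### Arbitrary bases over a field, and descent to a domain -/

section BaseChange

open scoped TensorProduct

namespace CliffordAlgebra

lemma exists_det_regularTraceForm_of_field {K V I : Type*} [Field K] [Invertible (2 : K)]
    [AddCommGroup V] [Module K V] [LinearOrder I] [Fintype I] (q : QuadraticForm K V)
    (b : Basis I K V) :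
    ∃ u : K, u ^ 2 = 1 ∧
      (LinearMap.BilinForm.toMatrix (monomialBasis q b)
        (regularTraceForm K (CliffordAlgebra q))).det =
      u * ((2 ^ Fintype.card I) ^ 2 ^ Fintype.card I *
        QuadraticForm.discr b q ^ 2 ^ (Fintype.card I - 1)) := by
  have : FiniteDimensional K V := Module.Finite.of_basis b
  have : NeZero (2 : K) := ⟨Invertible.ne_zero 2⟩
  -- Nondegeneracy is not needed: some $q(c_i)$ may vanish.
  obtain ⟨v, hv⟩ := LinearMap.BilinForm.exists_orthogonal_basis
    (B := QuadraticMap.associated (R := K) q)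
    ⟨QuadraticMap.associated_isSymm K q⟩
  let c : Basis I K V := v.reindex (v.indexEquiv b)
  have hc : (QuadraticMap.associated (R := K) q).IsOrthoᵢ c := by
    intro i j hij
    simp only [c, Function.onFun, Basis.reindex_apply]
    exact hv (fun h => hij ((v.indexEquiv b).symm.injective h))
  obtain ⟨u, hu, h⟩ := exists_det_regularTraceForm_of_isOrtho hc
  refine ⟨u, hu, ?_⟩
  -- `equivExterior` does not depend on the basis, so it cancels.
  have h1 : (monomialBasis q c).toMatrix (monomialBasis q b) =
      c.ExteriorAlgebra.toMatrix b.ExteriorAlgebra := by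
    ext S U
    simp only [monomialBasis, Basis.toMatrix_apply, Basis.map_apply, Basis.map_repr,
      LinearEquiv.trans_apply, LinearEquiv.symm_symm, LinearEquiv.apply_symm_apply]
  have h2 : QuadraticForm.discr c q = ∏ i, q (c i) := by
    rw [QuadraticForm.discr, ← Matrix.det_diagonal]
    congr 1
    ext i j
    rw [QuadraticForm.toMatrix, LinearMap.toMatrix₂_apply, Matrix.diagonal_apply]
    split_ifs with hij
    · rw [← hij, QuadraticMap.associated_eq_self_apply]
    · exact hc hij
  have h3 : QuadraticForm.discr b q = (c.toMatrix b).det ^ 2 * QuadraticForm.discr c q := by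
    have := QuadraticForm.discr_comp (b := b) c q LinearMap.id
    rw [LinearMap.toMatrix_id_eq_basis_toMatrix, ← sq] at this
    exact this
  rw [det_regularTraceForm_toMatrix_change (monomialBasis q c), h, h1,
    ExteriorAlgebra.det_basis_toMatrix, h3, h2]
  ring

variable {R V : Type*} (K : Type*) [CommRing R] [CommRing K] [Algebra R K] [AddCommGroup V]
  [Module R V]

/-- The canonical map from an exterior algebra to that of an extension of scalars. -/
noncomputable def exteriorToBaseChange :
    ExteriorAlgebra R V →ₐ[R] ExteriorAlgebra K (K ⊗[R] V) :=
  ExteriorAlgebra.lift R ⟨(ExteriorAlgebra.ι K).restrictScalars R ∘ₗ TensorProduct.mk R K V 1,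
    fun v => ExteriorAlgebra.ι_sq_zero (R := K) ((1 : K) ⊗ₜ[R] v)⟩

lemma exteriorToBaseChange_ι (v : V) :
    exteriorToBaseChange K (ExteriorAlgebra.ι R v) = ExteriorAlgebra.ι K ((1 : K) ⊗ₜ[R] v) :=
  ExteriorAlgebra.lift_ι_apply _ _ _ _

lemma exteriorToBaseChange_basis {I : Type*} [LinearOrder I] (b : Basis I R V) (S : Finset I) :
    exteriorToBaseChange K (b.ExteriorAlgebra S) = (b.baseChange K).ExteriorAlgebra S := by
  rw [ExteriorAlgebra.basis_apply_ofCard b rfl, ExteriorAlgebra.basis_apply_ofCard _ rfl,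
    ExteriorAlgebra.ιMulti_family, ExteriorAlgebra.ιMulti_family, ExteriorAlgebra.ιMulti_apply,
    ExteriorAlgebra.ιMulti_apply, map_list_prod, List.map_ofFn]
  simp only [Function.comp_def, exteriorToBaseChange_ι, Basis.baseChange_apply]

lemma exteriorToBaseChange_contractLeft (d : Module.Dual R V) (d' : Module.Dual K (K ⊗[R] V))
    (h : ∀ v, d' (1 ⊗ₜ v) = algebraMap R K (d v)) (y : ExteriorAlgebra R V) :
    exteriorToBaseChange K (contractLeft d y) = contractLeft d' (exteriorToBaseChange K y) := by
  induction y using CliffordAlgebra.left_induction with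
  | algebraMap r =>
    rw [contractLeft_algebraMap, map_zero, AlgHom.commutes,
      IsScalarTower.algebraMap_apply R K, contractLeft_algebraMap]
  | add x y hx hy => rw [map_add, map_add, hx, hy, map_add, map_add]
  | ι_mul x m hx =>
    rw [contractLeft_ι_mul, map_sub, map_smul, map_mul, map_mul, hx]
    rw [show exteriorToBaseChange K (ι (0 : QuadraticForm R V) m) = _ from
      exteriorToBaseChange_ι K m]
    rw [contractLeft_ι_mul, h, algebraMap_smul]

variable [Invertible (2 : R)] [Invertible (2 : K)]

/-- Both sides obey the same wedge-plus-contraction recursion. Hence scalar extension carries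
monomial bases to monomial bases, and trace-form determinants to their images. -/
lemma equivExterior_ofBaseChangeAux (q : QuadraticForm R V) (y : CliffordAlgebra q) :
    equivExterior (q.baseChange K) (ofBaseChangeAux K q y) =
      exteriorToBaseChange K (equivExterior q y) := by
  induction y using CliffordAlgebra.left_induction with
  | algebraMap r =>
    rw [AlgHom.commutes, IsScalarTower.algebraMap_apply R K]
    refine (changeForm_algebraMap changeForm.associated_neg_proof _).trans ?_
    rw [show equivExterior q (algebraMap R _ r) = _ from
      changeForm_algebraMap changeForm.associated_neg_proof _,
      AlgHom.commutes, IsScalarTower.algebraMap_apply R K (ExteriorAlgebra K (K ⊗[R] V))]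
  | add x y hx hy => rw [map_add, map_add, hx, hy, map_add, map_add]
  | ι_mul x m hx =>
    rw [map_mul, ofBaseChangeAux_ι, equivExterior_ι_mul, hx, equivExterior_ι_mul, map_add, map_mul,
      exteriorToBaseChange_ι, exteriorToBaseChange_contractLeft K _
        (QuadraticMap.associated (R := K) (q.baseChange K) (1 ⊗ₜ m))]
    intro v
    rw [QuadraticForm.associated_baseChange]
    simp [Algebra.algebraMap_eq_smul_one]

lemma ofBaseChangeAux_monomialBasis {I : Type*} [LinearOrder I] (q : QuadraticForm R V)
    (b : Basis I R V) (S : Finset I) :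
    monomialBasis (q.baseChange K) (b.baseChange K) S =
      ofBaseChangeAux K q (monomialBasis q b S) := by
  apply (equivExterior (q.baseChange K)).injective
  rw [equivExterior_ofBaseChangeAux, equivExterior_monomialBasis, equivExterior_monomialBasis,
    exteriorToBaseChange_basis]

lemma discr_baseChange {I : Type*} [Fintype I] [DecidableEq I] (q : QuadraticForm R V)
    (b : Basis I R V) :
    QuadraticForm.discr (b.baseChange K) (q.baseChange K) =
      algebraMap R K (QuadraticForm.discr b q) := by
  rw [QuadraticForm.discr, QuadraticForm.discr, RingHom.map_det]
  congr 1
  ext i j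
  rw [QuadraticForm.toMatrix, QuadraticForm.associated_baseChange]
  simp [QuadraticForm.toMatrix, LinearMap.toMatrix₂_apply, Algebra.algebraMap_eq_smul_one]

/-- The discriminant of a Clifford algebra in a monomial basis. -/
lemma associated_det_regularTraceForm {T V I : Type*} [CommRing T] [IsDomain T]
    [Invertible (2 : T)] [AddCommGroup V] [Module T V] [LinearOrder I] [Fintype I]
    (q : QuadraticForm T V) (b : Basis I T V) :
    Associated (LinearMap.BilinForm.toMatrix (monomialBasis q b)
        (regularTraceForm T (CliffordAlgebra q))).det
      (QuadraticForm.discr b q ^ 2 ^ (Fintype.card I - 1)) := by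
  let K := FractionRing T
  let : Invertible (2 : K) := (Invertible.map (algebraMap T K) 2).copy 2 (map_ofNat _ _).symm
  obtain ⟨u, hu, h⟩ := exists_det_regularTraceForm_of_field (q.baseChange K) (b.baseChange K)
  rw [det_regularTraceForm_map (ofBaseChangeAux K q) (monomialBasis q b) _
    (ofBaseChangeAux_monomialBasis K q b), discr_baseChange] at h
  have h2 : IsUnit (2 : T) := isUnit_of_invertible 2
  set D := (LinearMap.BilinForm.toMatrix (monomialBasis q b)
        (regularTraceForm T (CliffordAlgebra q))).det
  have key (w : T) (hw : w ^ 2 = 1) (hwu : algebraMap T K w = u) :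
      Associated D (QuadraticForm.discr b q ^ 2 ^ (Fintype.card I - 1)) := by
    have hD : D = (w * (2 ^ Fintype.card I) ^ 2 ^ Fintype.card I) *
        QuadraticForm.discr b q ^ 2 ^ (Fintype.card I - 1) := by
      apply IsFractionRing.injective T K
      rw [h, ← hwu, map_mul, map_mul, map_pow, map_pow, map_pow, map_ofNat, mul_assoc]
    have hwu : IsUnit w := IsUnit.of_mul_eq_one w (by rw [← sq, hw])
    rw [hD]
    exact associated_unit_mul_left _ _ (hwu.mul ((h2.pow _).pow _))
  -- In a field $u=\pm1$, so $u$ comes from a unit of $T$.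
  rcases sq_eq_one_iff.1 hu with rfl | rfl
  · exact key 1 (by simp) (by simp)
  · exact key (-1) (by simp) (by simp)

end CliffordAlgebra

end BaseChange

theorem theorem3p7 {T V : Type*} [CommRing T] [IsDomain T] [Invertible (2 : T)]
    [AddCommGroup V] [Module T V] (n : ℕ) (hn : 1 ≤ n) (x : Module.Basis (Fin n) T V)
    (q : QuadraticForm T V) :
    -- `T` is a central subalgebra of `C(V, q)`, over which `C(V, q)` is free of finite rank
    Function.Injective (algebraMap T (CliffordAlgebra q)) ∧
    Module.Free T (CliffordAlgebra q) ∧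
    Module.Finite T (CliffordAlgebra q) ∧
    -- the matrix `(x i * x j + x j * x i)` has its entries in `T`, that is, it is the matrix `M`
    ∃ M : Matrix (Fin n) (Fin n) T,
      (∀ i j, algebraMap T (CliffordAlgebra q) (M i j) =
        CliffordAlgebra.ι q (x i) * CliffordAlgebra.ι q (x j) +
          CliffordAlgebra.ι q (x j) * CliffordAlgebra.ι q (x i)) ∧
      (∀ (r : ℕ) (z : Module.Basis (Fin r) T (CliffordAlgebra q)),
        Associated (basisDiscriminant z) (M.det ^ 2 ^ (n - 1))) ∧
      Associated (M.det ^ 2 ^ (n - 1)) (QuadraticForm.discr x q ^ 2 ^ (n - 1)) := by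
  let c := CliffordAlgebra.monomialBasis q x
  have h2 : IsUnit (2 : T) := isUnit_of_invertible 2
  -- The anticommutator is the polar form, twice the Gram matrix of $b$.
  refine ⟨?_, Module.Free.of_basis c, Module.Finite.of_basis c, (2 : T) • q.toMatrix x, ?_, ?_, ?_⟩
  · intro s t h
    have h' := congrArg (CliffordAlgebra.equivExterior q) h
    rw [show CliffordAlgebra.equivExterior q (algebraMap T _ s) = _ from
        CliffordAlgebra.changeForm_algebraMap CliffordAlgebra.changeForm.associated_neg_proof _,
      show CliffordAlgebra.equivExterior q (algebraMap T _ t) = _ from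
        CliffordAlgebra.changeForm_algebraMap CliffordAlgebra.changeForm.associated_neg_proof _] at h'
    exact (ExteriorAlgebra.algebraMap_inj V s t).1 h'
  · intro i j
    rw [CliffordAlgebra.ι_mul_ι_add_swap, Matrix.smul_apply, QuadraticForm.toMatrix,
      LinearMap.toMatrix₂_apply, QuadraticMap.associated_apply]
    simp [QuadraticMap.polar]
  · intro r z
    refine (associated_basisDiscriminant z c).trans ?_
    refine (CliffordAlgebra.associated_det_regularTraceForm q x).trans ?_
    rw [Matrix.det_smul, mul_pow, Fintype.card_fin]
    exact (associated_unit_mul_left _ _ ((h2.pow _).pow _)).symm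
  · rw [Matrix.det_smul, mul_pow]
    exact associated_unit_mul_left _ _ ((h2.pow _).pow _)
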